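/- Let $N\ge 1$. Write $q\in\{0,1\}^N$ for the $z$-basis labels of $N$ qubits and $v_j=(-1)^{q_j}$. States are not normalised. An $N$-qubit *stabilizer state* $\Psi\ne 0$ is the unique (up to scalars) common $+1$ eigenvector of $N$ commuting elements of the Pauli group that are independent (removing any one of them generates a smaller group). For a simple graph $G$ on $\{1,\dots,N\}$, the *graph state* is $\Psi_G=\prod_{\{j,k\}\in E(G)}\mathrm{CZ}_{jk}\,|+\rangle^{\otimes N}$, and a *Jastrow state over $G$* has amplitudes $\exp\bigl(\sum_j b_jv_j+\sum_{\{j,k\}\in E(G)}V_{jk}v_jv_k\bigr)$ with complex $b_j,V_{jk}$. An *NQS tensor network* with $M$ hidden units is given by $2\times2$ coupling matrices $C^{(ij)}$ ($1\le i\le M$, $1\le j\le N$) and has amplitudes $\prod_{i=1}^M\sum_{h}\prod_{j=1}^N C^{(ij)}_{h\,q_j}$. For an ordered vertex cover $c=(c_1,\dots,c_M)$ of $G$, the network $\mathtt{graph2nqs}(G,c)$ links hidden unit $i$ to visible unit $c_i$ with $C^{(ic_i)}=\mathbb 1$, and to every neighbour $j$ of $c_i$ with $j\notin\{c_1,\dots,c_{i-1}\}$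 with $C^{(ij)}=\begin{pmatrix}1&1\\1&-1\end{pmatrix}$; all other $C^{(ij)}$ are all-ones (no link). The *valency* of visible unit $j$ is the number of hidden units linked to it. **Theorem.** For every $N$-qubit stabilizer state $\Psi$ there are a graph $G$ on $\{1,\dots,N\}$, an ordered vertex cover $c$ of $G$ with $M=|c|\le N-1$, and single-qubit Clifford gates $u_1,\dots,u_N$ such that: 1. for each $j$, either $u_j$ is diagonal in the $z$ basis or $j$ has valency at most $1$ in $\mathtt{graph2nqs}(G,c)$; 2. up to a non-zero scalar, $\Psi=(u_1\otimes\cdots\otimes u_N)\Psi_G$; 3. $\Psi$ is a vertex-modified Jastrow state: up to a non-zero scalar, $\Psi=\bigl(\prod_{j\in\mathcal Q}\hat Q_j\bigr)\Psi_{\rm JS}$ for some Jastrow state $\Psi_{\rm JS}$ over $G$ and single-qubit operators $\hat Q_j$ on the set $\mathcal Q$ of visible units of valency at most $1$; 4. if $N\ge 2$, then, up to a non-zero scalar, $\Psi$ is exactly the state of the NQS tensor network with these $M$ hidden units obtained from $\mathtt{graph2nqs}(G,c)$ by absorbing each gate $u_j$ into a single coupling matrix, $C^{(\sigma(j)j)}\mapsto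 C^{(\sigma(j)j)}u_j^{T}$ for some hidden unit $\sigma(j)$, which is linked to $j$ whenever $j$ has positive valency; 5. $\Psi$ is, up to scalar factors, a limit of complex restricted Boltzmann machine states $\sum_{h\in\{\pm1\}^M}\exp\bigl(\sum_j a_jv_j+\sum_i b_ih_i+\sum_{i,j}w_{ij}h_iv_j\bigr)$ with the same $M$ hidden units and $w_{ij}=0$ whenever $i$ and $j$ are not linked. -/

import Mathlib

noncomputable section

open scoped Matrix

namespace StabNQS

/-- The Pauli matrix `X`. Index `0` is the `z`-basis state `v = +1`, index `1` is `v = -1`. -/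
def pauliX : Matrix (Fin 2) (Fin 2) ℂ := !![0, 1; 1, 0]

/-- The Pauli matrix `Y`. -/
def pauliY : Matrix (Fin 2) (Fin 2) ℂ := !![0, -Complex.I; Complex.I, 0]

/-- The Pauli matrix `Z`. -/
def pauliZ : Matrix (Fin 2) (Fin 2) ℂ := !![1, 0; 0, -1]

/-- `IsPauli p` : `p` is one of the four matrices `1, X, Y, Z`. -/
def IsPauli (p : Matrix (Fin 2) (Fin 2) ℂ) : Prop :=
  p = 1 ∨ p = pauliX ∨ p = pauliY ∨ p = pauliZ

/-- `IsPhase τ` : `τ ∈ {1, -1, i, -i}`. -/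
def IsPhase (τ : ℂ) : Prop :=
  τ = 1 ∨ τ = -1 ∨ τ = Complex.I ∨ τ = -Complex.I

/-- The basis labels of `N` qubits: `q j = 0` means `v j = +1`, `q j = 1` means `v j = -1`. -/
abbrev Config (N : ℕ) := Fin N → Fin 2

/-- Operators on `N` qubits, as matrices in the `z` basis. -/
abbrev Op (N : ℕ) := Matrix (Config N) (Config N) ℂ

/-- The tensor product `u 0 ⊗ ⋯ ⊗ u (N - 1)` of single-spin operators. -/
def tensorOp {N : ℕ} (u : Fin N → Matrix (Fin 2) (Fin 2) ℂ) : Op N :=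
  Matrix.of fun q q' => ∏ j, u j (q j) (q' j)

/-- Membership in the Pauli group on `N` qubits: `τ • (p 0 ⊗ ⋯ ⊗ p (N - 1))`. -/
def IsPauliGroupElement {N : ℕ} (P : Op N) : Prop :=
  ∃ (τ : ℂ) (p : Fin N → Matrix (Fin 2) (Fin 2) ℂ),
    IsPhase τ ∧ (∀ j, IsPauli (p j)) ∧ P = τ • tensorOp p

/-- `Ψ` (not necessarily normalised) is a stabilizer state: there are `N` commuting, independent
elements `T a` of the Pauli group, independent in the sense that dropping a generator gives a
smaller group, such that `Ψ` is the unique vector, up to scalars, that all of them fix. -/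
def IsStabilizerState {N : ℕ} (Ψ : Config N → ℂ) : Prop :=
  ∃ T : Fin N → (Op N)ˣ,
    (∀ a, IsPauliGroupElement (T a : Op N)) ∧
    (∀ a b, Commute (T a) (T b)) ∧
    (∀ a, Subgroup.closure (T '' {b | b ≠ a}) < Subgroup.closure (Set.range T)) ∧
    Ψ ≠ 0 ∧
    (∀ a, (T a : Op N) *ᵥ Ψ = Ψ) ∧
    (∀ Φ : Config N → ℂ, (∀ a, (T a : Op N) *ᵥ Φ = Φ) → ∃ κ : ℂ, Φ = κ • Ψ)

/-- The single-qubit Pauli group `{τ • p}`. -/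
def pauliGroupOne : Set (Matrix (Fin 2) (Fin 2) ℂ) :=
  {P | ∃ (τ : ℂ) (p : Matrix (Fin 2) (Fin 2) ℂ), IsPhase τ ∧ IsPauli p ∧ P = τ • p}

/-- The single-qubit Clifford group: unitaries that map the Pauli group onto itself under
conjugation. -/
def IsLocalClifford (u : Matrix (Fin 2) (Fin 2) ℂ) : Prop :=
  u ∈ Matrix.unitaryGroup (Fin 2) ℂ ∧ (fun P => u * P * uᴴ) '' pauliGroupOne = pauliGroupOne

open Classical in
/-- The edges of a graph on `Fin N`, each listed once as `(s, t)` with `s < t`. -/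
def edgePairs {N : ℕ} (G : SimpleGraph (Fin N)) : Finset (Fin N × Fin N) :=
  Finset.univ.filter fun e => e.1 < e.2 ∧ G.Adj e.1 e.2

/-- The (unnormalised) graph state `∏_{(j,k) ∈ E(G)} CZ_{jk} |+⟩ ⋯ |+⟩`, where `|+⟩ = (1, 1)` and
the diagonal gate `CZ_{jk}` multiplies the amplitude by `-1` if `q j = q k = 1`. -/
def graphState {N : ℕ} (G : SimpleGraph (Fin N)) : Config N → ℂ :=
  fun q => ∏ e ∈ edgePairs G, if q e.1 = 1 ∧ q e.2 = 1 then -1 else 1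

/-- The spin value `v = (-1) ^ q`. -/
def spin (q : Fin 2) : ℂ := if q = 0 then 1 else -1

/-- The Jastrow state over `G` with biases `b` and pair interactions `V`. -/
def jastrowState {N : ℕ} (G : SimpleGraph (Fin N)) (b : Fin N → ℂ) (V : Fin N → Fin N → ℂ) :
    Config N → ℂ :=
  fun q => Complex.exp (∑ j, b j * spin (q j) +
    ∑ e ∈ edgePairs G, V e.1 e.2 * spin (q e.1) * spin (q e.2))

/-- `c` lists, in order and without repetition, the vertices of a vertex cover of `G`. -/
def IsOrderedVertexCover {N : ℕ} (G : SimpleGraph (Fin N)) (c : List (Fin N)) : Prop :=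
  c.Nodup ∧ G.IsVertexCover {v | v ∈ c}

/-- The connectivity that `graph2nqs` produces from `G` and the ordered vertex cover `c`: the
hidden unit of the `i`-th member of the cover is joined to the visible unit of that member, and to
its neighbours that are not among the previous members of the cover. -/
def Linked {N : ℕ} (G : SimpleGraph (Fin N)) (c : List (Fin N))
    (i : Fin c.length) (j : Fin N) : Prop :=
  j = c.get i ∨ (G.Adj (c.get i) j ∧ j ∉ c.take i)

open Classical in
/-- The valency of a visible unit: the number of hidden units it is joined to. -/
def valency {N : ℕ} (G : SimpleGraph (Fin N)) (c : List (Fin N)) (j : Fin N) : ℕ :=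
  (Finset.univ.filter fun i : Fin c.length => Linked G c i j).card

/-- The data of an NQS tensor network with `M` hidden and `N` visible units: coupling matrices
`C i j`, with row index `h i` and column index `v j`. -/
abbrev Couplings (M N : ℕ) := Fin M → Fin N → Matrix (Fin 2) (Fin 2) ℂ

/-- The amplitudes `∏ i, ∑ h, ∏ j, C i j h (q j)` of an NQS tensor network. -/
def nqsState {M N : ℕ} (C : Couplings M N) : Config N → ℂ :=
  fun q => ∏ i, ∑ h : Fin 2, ∏ j, C i j h (q j)

open Classical in
/-- The network `graph2nqs` for the graph state of `G`: the identity matrix (perfect correlation)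
between a hidden unit and its own visible unit, the edge matrix of the graph state on the other
links, and the all-ones matrix (no coupling) elsewhere. -/
def graph2nqs {N : ℕ} (G : SimpleGraph (Fin N)) (c : List (Fin N)) : Couplings c.length N :=
  fun i j =>
    if j = c.get i then 1
    else if Linked G c i j then !![1, 1; 1, -1]
    else !![1, 1; 1, 1]

/-- Absorption of single-spin gates: the gate `u j` is contracted with the visible leg of the one
coupling matrix between visible unit `j` and hidden unit `σ j`. -/
def absorb {M N : ℕ} (u : Fin N → Matrix (Fin 2) (Fin 2) ℂ) (σ : Fin N → Fin M)
    (C : Couplings M N) : Couplings M N :=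
  fun i j => if i = σ j then C i j * (u j)ᵀ else C i j

/-- The amplitudes of a complex RBM with visible biases `a`, hidden biases `b` and weights `w`. -/
def rbmState {M N : ℕ} (a : Fin N → ℂ) (b : Fin M → ℂ) (w : Fin M → Fin N → ℂ) : Config N → ℂ :=
  fun q => ∑ h : Fin M → Fin 2,
    Complex.exp (∑ j, a j * spin (q j) + ∑ i, b i * spin (h i) +
      ∑ i, ∑ j, w i j * spin (h i) * spin (q j))

/-- `Ψ` is, up to a non-zero scalar, a Jastrow state over `G` with arbitrary single-spin operators
applied to visible units that are joined to at most one hidden unit in the network that `graph2nqs`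
builds from `G` and the ordered vertex cover `c`. -/
def IsVMJState {N : ℕ} (G : SimpleGraph (Fin N)) (c : List (Fin N)) (Ψ : Config N → ℂ) : Prop :=
  ∃ (b : Fin N → ℂ) (V : Fin N → Fin N → ℂ) (Q : Fin N → Matrix (Fin 2) (Fin 2) ℂ) (κ : ℂ),
    (∀ j, 1 < valency G c j → Q j = 1) ∧ κ ≠ 0 ∧
    Ψ = κ • (tensorOp Q *ᵥ jastrowState G b V)

/-- `Ψ` is, up to scalars, the limit of amplitudes of complex RBMs with the connectivity that
`graph2nqs` builds from `G` and `c`; the limit accounts for diverging parameters, which encode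
vanishing entries of the coupling matrices. -/
def IsRBMLimit {N : ℕ} (G : SimpleGraph (Fin N)) (c : List (Fin N)) (Ψ : Config N → ℂ) : Prop :=
  ∃ (s : ℕ → ℂ) (a : ℕ → Fin N → ℂ) (b : ℕ → Fin c.length → ℂ)
    (w : ℕ → Fin c.length → Fin N → ℂ),
    (∀ n i j, ¬ Linked G c i j → w n i j = 0) ∧
    ∀ q, Filter.Tendsto (fun n => s n * rbmState (a n) (b n) (w n) q) Filter.atTop (nhds (Ψ q))

end StabNQS

end

open scoped Matrix

namespace StabNQS

/-! A Pauli operator translates labels by some `x` and multiplies amplitudes by a phase and a sign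
linear in `q`. Cutting `Ψ` down to one coset of the group `L` of such translation symmetries gives
another vector fixed by all generators, so uniqueness puts the support of `Ψ` in a single coset
(`IsStabilizerState.exists_support`). Take coordinates `F` that parametrise `L` bijectively. On the
support, labels outside `F` are affine functions of those in `F`, and moving along the dual basis of
`L` shows the amplitude to be a product of fourth roots of unity and pair signs
(`IsStabilizerState.exists_normal_form`). The pair signs are CZ gates inside `F`, the phases are
diagonal gates on `F`, and each affine constraint on a qubit `t ∉ F` is a Hadamard gate, up to a bit
flip, after CZ gates joining `t` to `F` (`IsStabilizerState.exists_graphState`). Non-diagonal gates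
therefore sit on an independent set. Listing that set first, then `F`, and dropping the last vertex
gives a cover in which these qubits have valency at most one (`exists_orderedVertexCover`). Such
gates pass through the network: a diagonal gate does not mix visible labels, and any other gate
meets at most one coupling depending on its qubit (`nqsState_absorb`). Logarithms of nonzero factors
then give the Jastrow and Boltzmann forms; zero coupling entries are reached as limits. -/

/-- The sign `(-1) ^ (a * b)`. -/
def signChar (a b : Fin 2) : ℂ := if a = 1 ∧ b = 1 then -1 else 1

theorem signChar_comm (a b : Fin 2) : signChar a b = signChar b a := by
  simp only [signChar, and_comm]

theorem signChar_add_right (a b c : Fin 2) :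
    signChar a (b + c) = signChar a b * signChar a c := by
  fin_cases a <;> fin_cases b <;> fin_cases c <;> simp [signChar]

theorem signChar_add_left (a b c : Fin 2) :
    signChar (a + b) c = signChar a c * signChar b c := by
  rw [signChar_comm, signChar_add_right, signChar_comm c a, signChar_comm c b]

@[simp] theorem signChar_zero_left (a : Fin 2) : signChar 0 a = 1 := by simp [signChar]

@[simp] theorem signChar_zero_right (a : Fin 2) : signChar a 0 = 1 := by simp [signChar]

theorem signChar_mul_self (a b : Fin 2) : signChar a b * signChar a b = 1 := by
  unfold signChar; split_ifs <;> simp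

open Classical in
/-- The amplitude of a graph state may be computed from any splitting of the edge signs between
the two orientations of each edge. -/
theorem graphState_eq_prod_prod {N : ℕ} (G : SimpleGraph (Fin N)) (q : Config N)
    (g : Fin N → Fin N → ℂ) (hdiag : ∀ s, g s s = 1)
    (hg : ∀ s t, s ≠ t → g s t * g t s = if G.Adj s t then signChar (q s) (q t) else 1) :
    graphState G q = ∏ s, ∏ t, g s t := by
  have h1 : ∏ s, ∏ t, g s t = ∏ s, ∏ t ∈ {s}ᶜ, g s t := by
    refine Finset.prod_congr rfl fun s _ => ?_
    rw [← Finset.prod_compl_mul_prod {s}]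
    simp [hdiag]
  rw [h1, ← Finset.prod_prod_Ioi_mul_eq_prod_prod_off_diag (fun a b => g b a)]
  unfold graphState edgePairs
  rw [Finset.prod_filter, ← Finset.univ_product_univ, Finset.prod_product]
  refine Finset.prod_congr rfl fun s _ => ?_
  have h2 : (Finset.Ioi s) = Finset.univ.filter (fun t => s < t) := by ext; simp
  rw [h2, Finset.prod_filter]
  refine Finset.prod_congr rfl fun t _ => ?_
  by_cases hst : s < t
  · simp only [hst, true_and, if_true]
    rw [hg s t hst.ne]
    rfl
  · simp [hst]

/-! ### Networks -/

/-- For a fixed hidden configuration the summand factors over visible sites; gates and logarithms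
are handled site by site in this form. -/
theorem nqsState_eq_sum {M N : ℕ} (C : Couplings M N) (q : Config N) :
    nqsState C q = ∑ h : Fin M → Fin 2, ∏ j, ∏ i, C i j (h i) (q j) := by
  unfold nqsState
  rw [Finset.prod_univ_sum]
  simp only [Fintype.piFinset_univ]
  exact Finset.sum_congr rfl fun h _ => Finset.prod_comm

/-- With the hidden labels fixed, gate `u j` only sums over the label at site `j`. The couplings to
units other than `σ j` leave that sum either because `u j` forces the label to be `q j` or because
they do not depend on it. -/
theorem nqsState_absorb {M N : ℕ} (u : Fin N → Matrix (Fin 2) (Fin 2) ℂ) (σ : Fin N → Fin M)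
    (C : Couplings M N)
    (h : ∀ j, (u j).IsDiag ∨ ∀ i, i ≠ σ j → ∀ k a b, C i j k a = C i j k b) :
    nqsState (absorb u σ C) = tensorOp u *ᵥ nqsState C := by
  funext q
  simp only [Matrix.mulVec, dotProduct, tensorOp, Matrix.of_apply, nqsState_eq_sum,
    Finset.mul_sum, ← Finset.prod_mul_distrib]
  rw [Finset.sum_comm]
  refine Finset.sum_congr rfl fun k _ => ?_
  have := (Finset.prod_univ_sum (fun _ : Fin N => (Finset.univ : Finset (Fin 2)))
    (fun j a => u j (q j) a * ∏ i, C i j (k i) a)).symm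
  simp only [Fintype.piFinset_univ] at this
  rw [this]
  refine Finset.prod_congr rfl fun j _ => ?_
  have hl : ∏ i, absorb u σ C i j (k i) (q j) =
      (∑ a, u j (q j) a * C (σ j) j (k (σ j)) a) *
        ∏ i ∈ {σ j}ᶜ, C i j (k i) (q j) := by
    rw [← Finset.prod_compl_mul_prod {σ j}, mul_comm, Finset.prod_singleton]
    congr 1
    · simp [absorb, Matrix.mul_apply, mul_comm]
    · refine Finset.prod_congr rfl fun i hi => ?_
      have : i ≠ σ j := by simpa using hi
      simp [absorb, this]
  rw [hl, Finset.sum_mul]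
  refine Finset.sum_congr rfl fun a _ => ?_
  rw [← Finset.prod_compl_mul_prod {σ j} (fun i => C i j (k i) a), Finset.prod_singleton]
  by_cases ha : a = q j
  · subst ha; ring
  rcases h j with h | h
  · have : u j (q j) a = 0 := h (Ne.symm ha)
    simp [this]
  · have : ∏ i ∈ {σ j}ᶜ, C i j (k i) (q j) = ∏ i ∈ {σ j}ᶜ, C i j (k i) a := by
      refine Finset.prod_congr rfl fun i hi => h i (by simpa using hi) _ _ _
    rw [this]; ring

theorem graph2nqs_apply_of_not_linked {N : ℕ} {G : SimpleGraph (Fin N)} {c : List (Fin N)}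
    {i : Fin c.length} {j : Fin N} (h : ¬ Linked G c i j) (k a : Fin 2) :
    graph2nqs G c i j k a = 1 := by
  have h1 : j ≠ c.get i := fun e => h (Or.inl e)
  simp only [graph2nqs, h, h1, if_false]
  fin_cases k <;> fin_cases a <;> rfl

theorem graph2nqs_apply_of_ne {N : ℕ} {G : SimpleGraph (Fin N)} {c : List (Fin N)}
    {i : Fin c.length} {j : Fin N} (hj : j ≠ c.get i) (k a : Fin 2) [Decidable (Linked G c i j)] :
    graph2nqs G c i j k a = if Linked G c i j then signChar k a else 1 := by
  split_ifs with h
  · simp only [graph2nqs, h, hj, if_false, if_true]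
    fin_cases k <;> fin_cases a <;> simp [signChar]
  · exact graph2nqs_apply_of_not_linked h k a

-- The identity coupling pins each hidden label to its cover vertex, so a hidden unit contributes
-- the signs of the edges from that vertex to vertices not listed before it. Every edge is counted
-- once, at its endpoint that comes first in the cover.
open Classical in
theorem nqsState_graph2nqs {N : ℕ} {G : SimpleGraph (Fin N)} {c : List (Fin N)}
    (hc : IsOrderedVertexCover G c) : nqsState (graph2nqs G c) = graphState G := by
  funext q
  have hmem : ∀ (i : ℕ) (t : Fin N), t ∈ c.take i ↔ c.idxOf t < min i c.length := by
    intro i t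
    constructor
    · intro h
      have h1 : t ∈ c := List.mem_of_mem_take h
      have h2 := List.idxOf_lt_length_of_mem h
      have h3 : (c.take i ++ c.drop i).idxOf t = (c.take i).idxOf t :=
        List.idxOf_append_of_mem h
      rw [List.take_append_drop] at h3
      rw [h3]
      simpa using h2
    · intro h
      have h1 : c.idxOf t < c.length := lt_of_lt_of_le h (min_le_right _ _)
      have h2 : c.idxOf t < i := lt_of_lt_of_le h (min_le_left _ _)
      have h3 : (c)[c.idxOf t] = t := List.getElem_idxOf h1
      exact List.mem_take_iff_getElem.2 ⟨_, h, h3⟩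
  -- Edges point from smaller to larger `idxOf`. Vertices outside the cover have index `c.length`,
  -- hence count as later than every member.
  rw [graphState_eq_prod_prod G q
    (fun s t => if G.Adj s t ∧ c.idxOf s < c.idxOf t then signChar (q s) (q t) else 1)]
  · have hout : ∀ s, s ∉ c → ∏ t, (if G.Adj s t ∧ c.idxOf s < c.idxOf t then
        signChar (q s) (q t) else 1) = 1 := by
      intro s hs
      refine Finset.prod_eq_one fun t _ => ?_
      rw [if_neg]
      rintro ⟨-, h⟩
      rw [List.idxOf_eq_length hs] at h
      exact absurd h (not_lt.2 List.idxOf_le_length)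
    have himg : c.toFinset = Finset.univ.image c.get := by
      ext s; simp [List.mem_iff_get]
    rw [← Finset.prod_subset (Finset.subset_univ c.toFinset)
      (fun s _ hs => hout s (by simpa using hs)), himg,
      Finset.prod_image (fun a _ b _ h => List.nodup_iff_injective_get.1 hc.1 h)]
    refine Finset.prod_congr rfl fun i _ => ?_
    have hidx : c.idxOf (c.get i) = i := List.get_idxOf hc.1 i
    have hlink : ∀ t, t ≠ c.get i →
        (Linked G c i t ↔ G.Adj (c.get i) t ∧ c.idxOf (c.get i) < c.idxOf t) := by
      intro t ht
      have hne : c.idxOf t ≠ i := by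
        intro h
        have h1 : t ∈ c := List.idxOf_lt_length_iff.1 (h ▸ i.2)
        exact ht ((List.idxOf_inj h1).1 (h.trans hidx.symm))
      have := i.2
      simp only [Linked, ht, false_or, hmem, hidx]
      refine and_congr_right fun _ => ?_
      omega
    have hterm : ∀ k, ∏ j, graph2nqs G c i j k (q j) = if k = q (c.get i) then
        ∏ t, (if G.Adj (c.get i) t ∧ c.idxOf (c.get i) < c.idxOf t then
          signChar k (q t) else 1) else 0 := by
      intro k
      rw [← Finset.prod_compl_mul_prod {c.get i}, Finset.prod_singleton]
      split_ifs with hk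
      · rw [← Finset.prod_compl_mul_prod {c.get i}, Finset.prod_singleton]
        congr 1
        · refine Finset.prod_congr rfl fun t ht => ?_
          have ht : t ≠ c.get i := by simpa using ht
          rw [graph2nqs_apply_of_ne ht]
          simp only [hlink t ht]
        · simp [graph2nqs, Matrix.one_apply, hk]
      · have : graph2nqs G c i (c.get i) k (q (c.get i)) = 0 := by
          simp only [graph2nqs, if_true, Matrix.one_apply, hk, if_false]
        rw [this, mul_zero]
    simp only [hterm, Finset.sum_ite_eq', Finset.mem_univ, if_true]
  · intro s; simp
  · intro s t hst
    by_cases hadj : G.Adj s t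
    · have hne : c.idxOf s ≠ c.idxOf t := by
        intro h
        rcases hc.2 hadj with hm | hm
        · exact hst ((List.idxOf_inj hm).1 h)
        · exact hst ((List.idxOf_inj hm).1 h.symm).symm
      rcases lt_or_gt_of_ne hne with h | h
      · simp [hadj, h, hadj.symm, h.not_gt]
      · simp [hadj, h, hadj.symm, h.not_gt, signChar_comm (q t)]
    · simp [hadj, mt G.adj_symm hadj]

/-! ### Jastrow states -/

theorem exists_eq_exp_spin (f : Fin 2 → ℂ) (hf : ∀ k, f k ≠ 0) :
    ∃ α β : ℂ, ∀ k, f k = Complex.exp (α + β * spin k) := by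
  refine ⟨(Complex.log (f 0) + Complex.log (f 1)) / 2,
    (Complex.log (f 0) - Complex.log (f 1)) / 2, fun k => ?_⟩
  rw [← Complex.exp_log (hf k)]
  congr 1
  fin_cases k <;> simp [spin] <;> ring

/-- The four exponents are the Walsh coefficients of the logarithms of the entries. The pair
coefficient vanishes for equal rows, which is how a missing link yields zero weight. -/
theorem exists_eq_exp_spin_spin (f : Fin 2 → Fin 2 → ℂ) (hf : ∀ h k, f h k ≠ 0) :
    ∃ γ α β w : ℂ, (f 0 = f 1 → w = 0) ∧
      ∀ h k, f h k = Complex.exp (γ + α * spin k + β * spin h + w * spin h * spin k) := by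
  set l := fun h k => Complex.log (f h k) with hl
  refine ⟨(l 0 0 + l 0 1 + l 1 0 + l 1 1) / 4, (l 0 0 - l 0 1 + l 1 0 - l 1 1) / 4,
    (l 0 0 + l 0 1 - l 1 0 - l 1 1) / 4, (l 0 0 - l 0 1 - l 1 0 + l 1 1) / 4,
    fun h => ?_, fun h k => ?_⟩
  · simp only [hl, h]; ring
  · rw [← Complex.exp_log (hf h k)]
    congr 1
    change l h k = _
    fin_cases h <;> fin_cases k <;> simp [spin] <;> ring

theorem signChar_eq_exp (a b : Fin 2) :
    signChar a b = Complex.exp (Real.pi * Complex.I / 4 *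
      (1 - spin a - spin b + spin a * spin b)) := by
  fin_cases a <;> fin_cases b <;> simp [spin, signChar]
  rw [← Complex.exp_pi_mul_I]; congr 1; ring

theorem exists_prod_mul_graphState_eq_jastrowState {N : ℕ} (G : SimpleGraph (Fin N))
    (f : Fin N → Fin 2 → ℂ) (hf : ∀ j k, f j k ≠ 0) :
    ∃ (b : Fin N → ℂ) (V : Fin N → Fin N → ℂ) (κ : ℂ), κ ≠ 0 ∧
      ∀ q, (∏ j, f j (q j)) * graphState G q = κ * jastrowState G b V q := by
  choose α β hαβ using fun j => exists_eq_exp_spin (f j) (hf j)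
  set g : ℂ := Real.pi * Complex.I / 4 with hg
  -- By `signChar_eq_exp`, each edge has pair term `g`, a constant `g`, and a linear term `-g` at
  -- both endpoints, which joins the biases.
  refine ⟨fun j => β j - ∑ e ∈ edgePairs G,
      ((if j = e.1 then g else 0) + (if j = e.2 then g else 0)), fun _ _ => g,
    Complex.exp (∑ j, α j + ∑ e ∈ edgePairs G, g), Complex.exp_ne_zero _, fun q => ?_⟩
  have h1 : graphState G q = ∏ e ∈ edgePairs G, signChar (q e.1) (q e.2) := rfl
  have h2 : ∑ j, (∑ e ∈ edgePairs G,
      ((if j = e.1 then g else 0) + (if j = e.2 then g else 0))) * spin (q j) =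
      ∑ e ∈ edgePairs G, (g * spin (q e.1) + g * spin (q e.2)) := by
    simp only [Finset.sum_mul]
    rw [Finset.sum_comm]
    refine Finset.sum_congr rfl fun e _ => ?_
    simp [add_mul, Finset.sum_add_distrib, ite_mul]
  rw [h1, jastrowState, ← Complex.exp_add]
  simp only [hαβ, signChar_eq_exp, ← hg]
  rw [← Complex.exp_sum, ← Complex.exp_sum, ← Complex.exp_add]
  congr 1
  simp only [sub_mul, Finset.sum_sub_distrib, h2]
  simp only [Finset.sum_add_distrib, mul_add, mul_sub, Finset.sum_sub_distrib, mul_one,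
    Finset.sum_const, nsmul_eq_mul, mul_assoc]
  ring

theorem tensorOp_mul {N : ℕ} (u w : Fin N → Matrix (Fin 2) (Fin 2) ℂ) :
    tensorOp u * tensorOp w = tensorOp fun j => u j * w j := by
  ext q r
  have := (Finset.prod_univ_sum (fun _ : Fin N => (Finset.univ : Finset (Fin 2)))
    (fun j a => u j (q j) a * w j a (r j))).symm
  simp only [Fintype.piFinset_univ] at this
  simp only [Matrix.mul_apply, tensorOp, Matrix.of_apply, ← Finset.prod_mul_distrib, this]

theorem tensorOp_mulVec_of_isDiag {N : ℕ} (u : Fin N → Matrix (Fin 2) (Fin 2) ℂ)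
    (h : ∀ j, (u j).IsDiag) (Φ : Config N → ℂ) (q : Config N) :
    (tensorOp u *ᵥ Φ) q = (∏ j, u j (q j) (q j)) * Φ q := by
  simp only [Matrix.mulVec, dotProduct, tensorOp, Matrix.of_apply]
  rw [Finset.sum_eq_single q _ (by simp)]
  intro r _ hr
  obtain ⟨j, hj⟩ := Function.ne_iff.1 hr
  rw [Finset.prod_eq_zero (Finset.mem_univ j) (h j (Ne.symm hj)), zero_mul]

theorem isDiag_apply_ne_zero {u : Matrix (Fin 2) (Fin 2) ℂ} (hu : IsUnit u) (h : u.IsDiag)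
    (k : Fin 2) : u k k ≠ 0 := by
  have h1 : u.det ≠ 0 := ((Matrix.isUnit_iff_isUnit_det u).1 hu).ne_zero
  rw [Matrix.det_fin_two, h (show (0 : Fin 2) ≠ 1 by decide), zero_mul, sub_zero] at h1
  fin_cases k
  · exact left_ne_zero_of_mul h1
  · exact right_ne_zero_of_mul h1

theorem isVMJState_of_eq_tensorOp {N : ℕ} {G : SimpleGraph (Fin N)} {c : List (Fin N)}
    {u : Fin N → Matrix (Fin 2) (Fin 2) ℂ} (hu : ∀ j, IsUnit (u j))
    (hd : ∀ j, (u j).IsDiag ∨ valency G c j ≤ 1) {Ψ : Config N → ℂ} {κ : ℂ} (hκ : κ ≠ 0)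
    (hΨ : Ψ = κ • (tensorOp u *ᵥ graphState G)) : IsVMJState G c Ψ := by
  classical
  -- Gates at valency above one are diagonal and nowhere zero on the diagonal, so `D` is absorbed in
  -- the Jastrow factor; `Q` keeps the others.
  set Q : Fin N → Matrix (Fin 2) (Fin 2) ℂ := fun j => if 1 < valency G c j then 1 else u j
  set D : Fin N → Matrix (Fin 2) (Fin 2) ℂ := fun j => if 1 < valency G c j then u j else 1
  have hQD : tensorOp u = tensorOp Q * tensorOp D := by
    rw [tensorOp_mul]
    congr 1
    funext j
    simp only [Q, D]
    split_ifs <;> simp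
  have hD : ∀ j, (D j).IsDiag := by
    intro j
    simp only [D]
    split_ifs with h
    · exact (hd j).resolve_right (by omega)
    · exact Matrix.isDiag_one
  have hDu : ∀ j, IsUnit (D j) := by
    intro j
    simp only [D]
    split_ifs with h
    · exact hu j
    · exact isUnit_one
  obtain ⟨b, V, κ', hκ', hJ⟩ := exists_prod_mul_graphState_eq_jastrowState G
    (fun j k => D j k k) (fun j k => isDiag_apply_ne_zero (hDu j) (hD j) k)
  refine ⟨b, V, Q, κ * κ', fun j hj => by simp [Q, hj], mul_ne_zero hκ hκ', ?_⟩
  have h1 : tensorOp D *ᵥ graphState G = κ' • jastrowState G b V := by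
    funext q
    rw [tensorOp_mulVec_of_isDiag D hD, hJ]
    rfl
  rw [hΨ, hQD, ← Matrix.mulVec_mulVec, h1, Matrix.mulVec_smul, smul_smul]

/-! ### Boltzmann machines -/

theorem exists_rbmState_eq {N M : ℕ} (f : Fin N → Fin 2 → ℂ) (hf : ∀ j k, f j k ≠ 0)
    (C : Couplings M N) (hC : ∀ i j h k, C i j h k ≠ 0) :
    ∃ (s : ℂ) (a : Fin N → ℂ) (b : Fin M → ℂ) (w : Fin M → Fin N → ℂ),
      (∀ i j, C i j 0 = C i j 1 → w i j = 0) ∧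
      ∀ q, s * rbmState a b w q = (∏ j, f j (q j)) * nqsState C q := by
  choose α β hf using fun j => exists_eq_exp_spin (f j) (hf j)
  choose g a b w hw hC using fun i j => exists_eq_exp_spin_spin (C i j) (hC i j)
  refine ⟨Complex.exp (∑ j, (α j + ∑ i, g i j)), fun j => β j + ∑ i, a i j,
    fun i => ∑ j, b i j, w, hw, fun q => ?_⟩
  rw [rbmState, nqsState_eq_sum, Finset.mul_sum, Finset.mul_sum]
  refine Finset.sum_congr rfl fun h _ => ?_
  simp only [hf, hC, ← Complex.exp_sum, ← Complex.exp_add]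
  congr 1
  simp only [Finset.sum_add_distrib, add_mul, Finset.sum_mul]
  rw [Finset.sum_comm (f := fun i j => b i j * spin (h i)),
    Finset.sum_comm (f := fun i j => w i j * spin (h i) * spin (q j))]
  ring

/-- Zero entries are replaced by `1 / (n + 1)`, so that logarithms exist. Equal rows stay equal, so
unlinked weights vanish for every `n`, not only in the limit. -/
theorem isRBMLimit_of_eq {N : ℕ} {G : SimpleGraph (Fin N)} {c : List (Fin N)}
    {Ψ : Config N → ℂ} (κ : ℂ) (f : Fin N → Fin 2 → ℂ) (C : Couplings c.length N)
    (hC : ∀ i j, ¬ Linked G c i j → C i j 0 = C i j 1)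
    (hΨ : ∀ q, Ψ q = κ * ((∏ j, f j (q j)) * nqsState C q)) : IsRBMLimit G c Ψ := by
  set r : ℕ → ℂ → ℂ := fun n z => if z = 0 then 1 / ((n : ℂ) + 1) else z
  have hr : ∀ n z, r n z ≠ 0 := by
    intro n z
    simp only [r]
    split_ifs with h
    · exact one_div_ne_zero (Nat.cast_add_one_ne_zero n)
    · exact h
  have hlim : ∀ z, Filter.Tendsto (fun n => r n z) Filter.atTop (nhds z) := by
    intro z
    by_cases h : z = 0
    · simp only [r, h, if_true]
      exact tendsto_one_div_add_atTop_nhds_zero_nat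
    · simp only [r, h, if_false]
      exact tendsto_const_nhds
  choose s a b w hw hs using fun n => exists_rbmState_eq (fun j k => r n (f j k))
    (fun j k => hr n _) (fun i j => Matrix.of fun h k => r n (C i j h k))
    (fun i j h k => hr n _)
  refine ⟨fun n => κ * s n, a, b, w, fun n i j hij => hw n i j ?_, fun q => ?_⟩
  · funext k
    simp only [Matrix.of_apply, hC i j hij]
  · simp only [mul_assoc, hs, hΨ]
    refine (Filter.Tendsto.mul ?_ ?_).const_mul κ
    · exact tendsto_finsetProd _ fun j _ => hlim _
    · exact tendsto_finsetProd _ fun i _ => tendsto_finsetSum _ fun h _ =>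
        tendsto_finsetProd _ fun j _ => hlim _

/-! ### Pauli operators and the support of a stabilizer state -/

/-- The sign `(-1) ^ (z ⬝ q)`. -/
def signVec {N : ℕ} (z q : Config N) : ℂ := ∏ j, signChar (z j) (q j)

theorem signVec_add_right {N : ℕ} (z q r : Config N) :
    signVec z (q + r) = signVec z q * signVec z r := by
  simp [signVec, signChar_add_right, Finset.prod_mul_distrib]

theorem signVec_add_left {N : ℕ} (z w q : Config N) :
    signVec (z + w) q = signVec z q * signVec w q := by
  simp [signVec, signChar_add_left, Finset.prod_mul_distrib]

theorem signVec_mul_self {N : ℕ} (z q : Config N) : signVec z q * signVec z q = 1 := by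
  simp [signVec, ← Finset.prod_mul_distrib, signChar_mul_self]

theorem signVec_ne_zero {N : ℕ} (z q : Config N) : signVec z q ≠ 0 :=
  left_ne_zero_of_mul_eq_one (signVec_mul_self z q)

theorem signVec_eq_one_or {N : ℕ} (z q : Config N) : signVec z q = 1 ∨ signVec z q = -1 :=
  mul_self_eq_one_iff.1 (signVec_mul_self z q)

@[simp] theorem signVec_zero_left {N : ℕ} (q : Config N) : signVec 0 q = 1 := by simp [signVec]

@[simp] theorem signVec_zero_right {N : ℕ} (z : Config N) : signVec z 0 = 1 := by simp [signVec]

theorem config_add_self {N : ℕ} (q : Config N) : q + q = 0 := by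
  funext j
  simp only [Pi.add_apply, Pi.zero_apply]
  generalize q j = a
  revert a; decide

theorem config_add_add_cancel {N : ℕ} (q r : Config N) : q + r + r = q := by
  rw [add_assoc, config_add_self, add_zero]

theorem IsPauli.exists_apply_eq {p : Matrix (Fin 2) (Fin 2) ℂ} (hp : IsPauli p) :
    ∃ (ω : ℂ) (x z : Fin 2), ω ≠ 0 ∧
      ∀ a b, p a b = if b = a + x then ω * signChar z b else 0 := by
  rcases hp with rfl | rfl | rfl | rfl
  · refine ⟨1, 0, 0, one_ne_zero, fun a b => ?_⟩
    fin_cases a <;> fin_cases b <;> simp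
  · refine ⟨1, 1, 0, one_ne_zero, fun a b => ?_⟩
    fin_cases a <;> fin_cases b <;> simp [pauliX]
  · refine ⟨Complex.I, 1, 1, Complex.I_ne_zero, fun a b => ?_⟩
    fin_cases a <;> fin_cases b <;> simp [pauliY, signChar]
  · refine ⟨1, 0, 1, one_ne_zero, fun a b => ?_⟩
    fin_cases a <;> fin_cases b <;> simp [pauliZ, signChar]

theorem IsPauliGroupElement.exists_mulVec_eq {N : ℕ} {P : Op N} (hP : IsPauliGroupElement P) :
    ∃ (ω : ℂ) (x z : Config N), ω ≠ 0 ∧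
      ∀ (Φ : Config N → ℂ) q, (P *ᵥ Φ) q = ω * signVec z (q + x) * Φ (q + x) := by
  obtain ⟨τ, p, hτ, hp, rfl⟩ := hP
  choose ω x z hω hpa using fun j => (hp j).exists_apply_eq
  have hτ0 : τ ≠ 0 := by
    rcases hτ with rfl | rfl | rfl | rfl <;> simp
  refine ⟨τ * ∏ j, ω j, x, z, mul_ne_zero hτ0 (Finset.prod_ne_zero_iff.2 fun j _ => hω j),
    fun Φ q => ?_⟩
  rw [Matrix.smul_mulVec, Pi.smul_apply, smul_eq_mul]
  simp only [Matrix.mulVec, dotProduct, tensorOp, Matrix.of_apply]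
  rw [Finset.sum_eq_single (q + x) _ (by simp)]
  · simp only [hpa, Pi.add_apply, if_true, Finset.prod_mul_distrib, signVec]
    ring
  · intro r _ hr
    obtain ⟨j, hj⟩ := Function.ne_iff.1 hr
    rw [Finset.prod_eq_zero (Finset.mem_univ j), zero_mul]
    rw [hpa]
    exact if_neg hj

/-- The translations under which a state changes by a phase and a `Z`-type sign only. -/
def translationGroup {N : ℕ} (Ψ : Config N → ℂ) : AddSubgroup (Config N) where
  carrier := {x | ∃ (τ : ℂ) (z : Config N), ∀ q, Ψ (q + x) = τ * signVec z q * Ψ q}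
  zero_mem' := ⟨1, 0, fun q => by simp⟩
  add_mem' := by
    rintro x y ⟨τ, z, h⟩ ⟨τ', z', h'⟩
    refine ⟨τ * τ' * signVec z' x, z + z', fun q => ?_⟩
    rw [← add_assoc, h', h, signVec_add_left, signVec_add_right]
    ring
  neg_mem' := by
    rintro x h
    rwa [neg_eq_of_add_eq_zero_left (config_add_self x)]

/-- Each generator translates by an element of `L`, so it preserves the truncation of `Ψ` to `q₀ +
L`. By uniqueness the truncation is a multiple of `Ψ`, nonzero because it agrees with `Ψ` at `q₀`.
-/
theorem IsStabilizerState.exists_support {N : ℕ} {Ψ : Config N → ℂ} (hΨ : IsStabilizerState Ψ) :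
    ∃ q₀, Ψ q₀ ≠ 0 ∧ ∀ q, Ψ q ≠ 0 → q + q₀ ∈ translationGroup Ψ := by
  classical
  obtain ⟨T, hT, -, -, hne, hfix, huniq⟩ := hΨ
  obtain ⟨q₀, hq₀⟩ := Function.ne_iff.1 hne
  refine ⟨q₀, hq₀, ?_⟩
  set L := translationGroup Ψ
  choose ω x z hω hact using fun a => (hT a).exists_mulVec_eq
  have hx : ∀ a, x a ∈ L := by
    intro a
    refine ⟨(ω a)⁻¹ * signVec (z a) (x a), z a, fun q => ?_⟩
    have h := congrFun (hfix a) q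
    rw [hact] at h
    rw [← h, signVec_add_right]
    have h1 := signVec_mul_self (z a) q
    have h2 := signVec_mul_self (z a) (x a)
    have h3 := inv_mul_cancel₀ (hω a)
    calc Ψ (q + x a) = ((ω a)⁻¹ * ω a) * (signVec (z a) (x a) * signVec (z a) (x a)) *
          (signVec (z a) q * signVec (z a) q) * Ψ (q + x a) := by rw [h1, h2, h3]; ring
      _ = _ := by ring
  obtain ⟨κ, hκ⟩ := huniq (fun q => if q + q₀ ∈ L then Ψ q else 0) (by
    intro a
    funext q
    rw [hact]
    have h := congrFun (hfix a) q
    rw [hact] at h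
    have hiff : q + x a + q₀ ∈ L ↔ q + q₀ ∈ L := by
      rw [add_right_comm, L.add_mem_cancel_right (hx a)]
    simp only [hiff]
    split_ifs
    · exact h
    · simp)
  have h0 := congrFun hκ q₀
  simp only [config_add_self, L.zero_mem, if_true, Pi.smul_apply, smul_eq_mul] at h0
  have hκ1 : κ ≠ 0 := by
    rintro rfl
    exact hq₀ (by simpa using h0)
  intro q hq
  by_contra hmem
  have h1 := congrFun hκ q
  simp only [hmem, if_false, Pi.smul_apply, smul_eq_mul] at h1
  exact mul_ne_zero hκ1 hq h1.symm

/-! ### Coordinates on a binary linear code -/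

theorem fin_two_eq_one_of_ne_zero {a : Fin 2} (h : a ≠ 0) : a = 1 := by
  revert a; decide

/-- A set `F` of coordinates such that restriction to `F` is a bijection from `L` to the
configurations on `F`, with the dual basis `X` of `L`. -/
theorem exists_information_set {N : ℕ} (L : AddSubgroup (Config N)) :
    ∃ (F : Finset (Fin N)) (X : Fin N → Config N), (∀ j ∈ F, X j ∈ L) ∧
      (∀ j ∈ F, ∀ k ∈ F, X j k = if j = k then 1 else 0) ∧
      ∀ x ∈ L, (∀ j ∈ F, x j = 0) → x = 0 := by
  classical
  have hex : ∃ F : Finset (Fin N), ∀ x ∈ L, (∀ j ∈ F, x j = 0) → x = 0 :=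
    ⟨Finset.univ, fun x _ h => funext fun j => h j (Finset.mem_univ j)⟩
  -- `F` is minimal among sets on which restriction is injective. Removing `j` destroys injectivity,
  -- so some nonzero word vanishes on the rest of `F` and must equal `1` at `j`.
  obtain ⟨F, hF, hmin⟩ := WellFounded.has_min (wellFounded_lt (α := Finset (Fin N)))
    {F | ∀ x ∈ L, (∀ j ∈ F, x j = 0) → x = 0} hex
  have hX : ∀ j ∈ F, ∃ x ∈ L, ∀ k ∈ F, x k = if j = k then 1 else 0 := by
    intro j hj
    have h := fun h => hmin (F.erase j) h (Finset.erase_ssubset hj)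
    simp only [Set.mem_ofPred_eq, imp_false, not_forall] at h
    obtain ⟨x, hxL, hx, hx0⟩ := h
    refine ⟨x, hxL, fun k hk => ?_⟩
    split_ifs with hjk
    · subst hjk
      refine fin_two_eq_one_of_ne_zero fun h0 => hx0 (hF x hxL fun k hk => ?_)
      by_cases hjk : k = j
      · rw [hjk, h0]
      · exact hx k (Finset.mem_erase.2 ⟨hjk, hk⟩)
    · exact hx k (Finset.mem_erase.2 ⟨Ne.symm hjk, hk⟩)
  choose! X hX hXF using hX
  exact ⟨F, X, hX, hXF, hF⟩

theorem sum_dual_apply {N : ℕ} {F : Finset (Fin N)} {X : Fin N → Config N}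
    (hX : ∀ j ∈ F, ∀ k ∈ F, X j k = if j = k then 1 else 0) (q : Config N) {k : Fin N}
    (hk : k ∈ F) : (∑ j ∈ F with q j = 1, X j) k = q k := by
  classical
  rw [Finset.sum_apply, Finset.sum_congr rfl fun j hj => hX j (Finset.mem_filter.1 hj).1 k hk,
    Finset.sum_ite_eq']
  by_cases h : q k = 1
  · simp [hk, h]
  · have : q k = 0 := by
      by_contra h0
      exact h (fin_two_eq_one_of_ne_zero h0)
    simp [this]

/-- The amplitudes of a state along a family of translation symmetries, by recursion along the
order of the indices. -/
theorem apply_add_sum_eq {N : ℕ} {Ψ : Config N → ℂ} {X z : Fin N → Config N} {τ : Fin N → ℂ}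
    {F : Finset (Fin N)} (h : ∀ j ∈ F, ∀ q, Ψ (q + X j) = τ j * signVec (z j) q * Ψ q)
    (q₀ : Config N) (J : Finset (Fin N)) (hJ : J ⊆ F) :
    Ψ (q₀ + ∑ j ∈ J, X j) = Ψ q₀ * ∏ j ∈ J, (τ j * signVec (z j) q₀ *
      ∏ k ∈ J with k < j, signVec (z j) (X k)) := by
  -- Adding the largest index last leaves the earlier products over `k < j` unchanged.
  induction J using Finset.induction_on_max with
  | empty => simp
  | insert m J hm ih =>
    have hmJ : m ∉ J := fun hmem => lt_irrefl _ (hm m hmem)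
    have hsum : ∀ K : Finset (Fin N), signVec (z m) (∑ k ∈ K, X k) =
        ∏ k ∈ K, signVec (z m) (X k) := by
      intro K
      induction K using Finset.cons_induction with
      | empty => simp
      | cons a K ha ihK => rw [Finset.sum_cons, Finset.prod_cons, signVec_add_right, ihK]
    rw [Finset.sum_insert hmJ, Finset.prod_insert hmJ, add_comm (X m), ← add_assoc,
      h m (hJ (Finset.mem_insert_self m J)),
      ih ((Finset.subset_insert m J).trans hJ), signVec_add_right, hsum]
    have h1 : (insert m J).filter (fun k => k < m) = J := by
      ext k
      simp only [Finset.mem_filter, Finset.mem_insert]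
      constructor
      · rintro ⟨rfl | hk, hlt⟩
        · exact absurd hlt (lt_irrefl _)
        · exact hk
      · exact fun hk => ⟨Or.inr hk, hm k hk⟩
    have h2 : ∀ j ∈ J, (insert m J).filter (fun k => k < j) = J.filter (fun k => k < j) := by
      intro j hj
      rw [Finset.filter_insert, if_neg (hm j hj).not_gt]
    have h3 : ∏ j ∈ J, (τ j * signVec (z j) q₀ *
        ∏ k ∈ insert m J with k < j, signVec (z j) (X k)) = ∏ j ∈ J, (τ j * signVec (z j) q₀ *
        ∏ k ∈ J with k < j, signVec (z j) (X k)) :=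
      Finset.prod_congr rfl fun j hj => by rw [h2 j hj]
    rw [h1, h3]
    ring

/-- The normal form of stabilizer states: outside an information set `F` the labels are affine
functions of those in `F`, and the amplitudes are given by phases `τ` and signs `σ`. -/
theorem IsStabilizerState.exists_normal_form {N : ℕ} {Ψ : Config N → ℂ}
    (hΨ : IsStabilizerState Ψ) :
    ∃ (F : Finset (Fin N)) (X : Fin N → Config N) (q₀ : Config N) (τ : Fin N → ℂ)
      (σ : Fin N → Fin N → ℂ) (κ : ℂ), κ ≠ 0 ∧
      (∀ j ∈ F, q₀ j = 0) ∧ (∀ j ∈ F, ∀ k ∈ F, X j k = if j = k then 1 else 0) ∧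
      (∀ j, IsPhase (τ j)) ∧ (∀ j k, σ j k = 1 ∨ σ j k = -1) ∧
      ∀ q, Ψ q = if q = q₀ + ∑ j ∈ F with q j = 1, X j then
        κ * ∏ j ∈ F with q j = 1, (τ j * ∏ k ∈ (F.filter fun k => q k = 1) with k < j, σ j k)
        else 0 := by
  classical
  obtain ⟨q₁, hq₁, hsupp⟩ := hΨ.exists_support
  obtain ⟨F, X, hXL, hXF, hF⟩ := exists_information_set (translationGroup Ψ)
  choose! τ z hτ using hXL
  have hnz : ∀ J ⊆ F, Ψ (q₁ + ∑ j ∈ J, X j) ≠ 0 := by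
    intro J hJ
    rw [apply_add_sum_eq hτ q₁ J hJ]
    refine mul_ne_zero hq₁ (Finset.prod_ne_zero_iff.2 fun j hj => mul_ne_zero (mul_ne_zero ?_
      (signVec_ne_zero _ _)) (Finset.prod_ne_zero_iff.2 fun k _ => signVec_ne_zero _ _))
    intro h0
    have := hτ j (hJ hj) (q₁ + X j)
    rw [config_add_add_cancel, h0] at this
    exact hq₁ (by simpa using this)
  -- The base point moves within its coset to vanish on `F`.
  set q₀ := q₁ + ∑ j ∈ F with q₁ j = 1, X j with hq₀
  have hq₀nz : Ψ q₀ ≠ 0 := hnz _ (Finset.filter_subset _ _)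
  have hq₀F : ∀ j ∈ F, q₀ j = 0 := by
    intro j hj
    rw [hq₀, Pi.add_apply, sum_dual_apply hXF q₁ hj]
    exact congrFun (config_add_self q₁) j
  -- Translating twice by `X j` is the identity, so the square of this factor is `1` or `-1`.
  have hphase : ∀ j ∈ F, IsPhase (τ j * signVec (z j) q₀) := by
    intro j hj
    have h1 := hτ j hj (q₀ + X j)
    rw [config_add_add_cancel, hτ j hj, signVec_add_right] at h1
    set t := τ j * signVec (z j) q₀
    have h2 : t * t * signVec (z j) (X j) = 1 := by
      refine mul_right_cancel₀ hq₀nz ?_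
      rw [one_mul]
      nth_rw 2 [h1]
      simp only [t]; ring
    rcases signVec_eq_one_or (z j) (X j) with h | h
    · rw [h, mul_one] at h2
      rcases mul_self_eq_one_iff.1 h2 with h | h
      · exact Or.inl h
      · exact Or.inr (Or.inl h)
    · rw [h] at h2
      have h3 : (t - Complex.I) * (t + Complex.I) = 0 := by
        linear_combination -h2 - Complex.I_mul_I
      rcases mul_eq_zero.1 h3 with h | h
      · exact Or.inr (Or.inr (Or.inl (sub_eq_zero.1 h)))
      · exact Or.inr (Or.inr (Or.inr (eq_neg_of_add_eq_zero_left h)))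
  refine ⟨F, X, q₀, fun j => if j ∈ F then τ j * signVec (z j) q₀ else 1,
    fun j k => signVec (z j) (X k), Ψ q₀, hq₀nz, hq₀F, hXF, fun j => ?_,
    fun j k => signVec_eq_one_or _ _, fun q => ?_⟩
  · dsimp only
    split_ifs with h
    · exact hphase j h
    · exact Or.inl rfl
  · split_ifs with h
    · conv_lhs => rw [h]
      rw [apply_add_sum_eq hτ q₀ _ (Finset.filter_subset _ _)]
      congr 1
      refine Finset.prod_congr rfl fun j hj => ?_
      simp only [if_pos (Finset.mem_filter.1 hj).1]
    · by_contra hq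
      have hsumL : ∀ r : Config N, ∑ j ∈ F with r j = 1, X j ∈ translationGroup Ψ := fun r =>
        sum_mem fun j hj => ⟨_, _, hτ j (Finset.mem_filter.1 hj).1⟩
      -- This vector lies in `L` and vanishes on `F`, so it is zero and `q` is the prescribed point.
      have h1 : q + q₀ + ∑ j ∈ F with q j = 1, X j = 0 := by
        refine hF _ ?_ fun j hj => ?_
        · rw [hq₀, ← add_assoc]
          exact add_mem (add_mem (hsupp q hq) (hsumL _)) (hsumL _)
        · rw [Pi.add_apply, Pi.add_apply, sum_dual_apply hXF q hj, hq₀F j hj, add_zero]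
          exact congrFun (config_add_self q) j
      apply h
      rw [add_assoc] at h1
      have h2 := congrArg (· + (q₀ + ∑ j ∈ F with q j = 1, X j)) h1
      simpa only [config_add_add_cancel, zero_add] using h2

/-! ### Single-qubit Clifford gates -/

/-- Conjugation by `uᴴ` inverts conjugation by `u`, so inclusions both ways give equality; phases
commute with both, leaving four matrices to check. -/
theorem isLocalClifford_of_conj_mem {u : Matrix (Fin 2) (Fin 2) ℂ}
    (hu : u ∈ Matrix.unitaryGroup (Fin 2) ℂ)
    (h₁ : ∀ p, IsPauli p → u * p * uᴴ ∈ pauliGroupOne)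
    (h₂ : ∀ p, IsPauli p → uᴴ * p * u ∈ pauliGroupOne) : IsLocalClifford u := by
  have hphase : ∀ τ τ' : ℂ, IsPhase τ → IsPhase τ' → IsPhase (τ * τ') := by
    rintro τ τ' (rfl | rfl | rfl | rfl) (rfl | rfl | rfl | rfl) <;> simp [IsPhase]
  have hsmul : ∀ (τ : ℂ) P, IsPhase τ → P ∈ pauliGroupOne → τ • P ∈ pauliGroupOne := by
    rintro τ _ hτ ⟨τ', p, hτ', hp, rfl⟩
    exact ⟨τ * τ', p, hphase _ _ hτ hτ', hp, smul_smul _ _ _⟩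
  have hu1 : u * uᴴ = 1 := Matrix.mem_unitaryGroup_iff.1 hu
  refine ⟨hu, Set.Subset.antisymm ?_ ?_⟩
  · rintro _ ⟨_, ⟨τ, p, hτ, hp, rfl⟩, rfl⟩
    simp only [Matrix.mul_smul, Matrix.smul_mul]
    exact hsmul _ _ hτ (h₁ p hp)
  · rintro _ ⟨τ, p, hτ, hp, rfl⟩
    refine ⟨τ • (uᴴ * p * u), hsmul _ _ hτ (h₂ p hp), ?_⟩
    simp only [Matrix.mul_smul, Matrix.smul_mul]
    congr 1
    calc u * (uᴴ * p * u) * uᴴ = (u * uᴴ) * p * (u * uᴴ) := by simp only [Matrix.mul_assoc]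
      _ = p := by rw [hu1, Matrix.one_mul, Matrix.mul_one]

/-- The diagonal gate `diag(1, τ)`. -/
def phaseGate (τ : ℂ) : Matrix (Fin 2) (Fin 2) ℂ := !![1, 0; 0, τ]

theorem phaseGate_isDiag (τ : ℂ) : (phaseGate τ).IsDiag := by
  intro a b hab
  fin_cases a <;> fin_cases b <;> simp_all [phaseGate]

theorem phaseGate_conj_mem {τ : ℂ} (hτ : IsPhase τ) {p : Matrix (Fin 2) (Fin 2) ℂ}
    (hp : IsPauli p) : phaseGate τ * p * (phaseGate τ)ᴴ ∈ pauliGroupOne := by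
  have hd : ∀ p : Matrix (Fin 2) (Fin 2) ℂ, phaseGate τ * p * (phaseGate τ)ᴴ =
      !![p 0 0, p 0 1 * star τ; τ * p 1 0, τ * p 1 1 * star τ] := by
    intro p
    ext a b
    fin_cases a <;> fin_cases b <;>
      simp only [phaseGate, Matrix.mul_apply, Fin.sum_univ_two, Matrix.conjTranspose_apply] <;> simp
  have hττ : τ * star τ = 1 := by rcases hτ with rfl | rfl | rfl | rfl <;> simp
  rw [hd]
  rcases hp with rfl | rfl | rfl | rfl
  · refine ⟨1, 1, Or.inl rfl, Or.inl rfl, ?_⟩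
    ext a b
    fin_cases a <;> fin_cases b <;> simp_all
  · rcases hτ with rfl | rfl | rfl | rfl
    · exact ⟨1, pauliX, by simp [IsPhase], by simp [IsPauli], by simp [pauliX]⟩
    · exact ⟨-1, pauliX, by simp [IsPhase], by simp [IsPauli], by simp [pauliX]⟩
    · exact ⟨1, pauliY, by simp [IsPhase], by simp [IsPauli], by simp [pauliX, pauliY]⟩
    · exact ⟨-1, pauliY, by simp [IsPhase], by simp [IsPauli], by simp [pauliX, pauliY]⟩
  · rcases hτ with rfl | rfl | rfl | rfl
    · exact ⟨1, pauliY, by simp [IsPhase], by simp [IsPauli], by simp [pauliY]⟩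
    · exact ⟨-1, pauliY, by simp [IsPhase], by simp [IsPauli], by simp [pauliY]⟩
    · exact ⟨-1, pauliX, by simp [IsPhase], by simp [IsPauli], by simp [pauliX, pauliY]⟩
    · exact ⟨1, pauliX, by simp [IsPhase], by simp [IsPauli], by simp [pauliX, pauliY]⟩
  · refine ⟨1, pauliZ, Or.inl rfl, by simp [IsPauli], ?_⟩
    ext a b
    fin_cases a <;> fin_cases b <;> simp_all [pauliZ]

theorem phaseGate_isLocalClifford {τ : ℂ} (hτ : IsPhase τ) : IsLocalClifford (phaseGate τ) := by
  have hstar : (phaseGate τ)ᴴ = phaseGate (star τ) := by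
    ext a b
    fin_cases a <;> fin_cases b <;> simp [phaseGate]
  have hτ' : IsPhase (star τ) := by
    rcases hτ with rfl | rfl | rfl | rfl <;> simp [IsPhase]
  refine isLocalClifford_of_conj_mem ?_ (fun p hp => phaseGate_conj_mem hτ hp) fun p hp => ?_
  · rw [Matrix.mem_unitaryGroup_iff, Matrix.star_eq_conjTranspose, hstar]
    have hττ : τ * star τ = 1 := by rcases hτ with rfl | rfl | rfl | rfl <;> simp
    ext a b
    fin_cases a <;> fin_cases b <;> simp [phaseGate]
    exact hττ
  · have := phaseGate_conj_mem hτ' hp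
    rwa [← hstar, Matrix.conjTranspose_conjTranspose] at this

/-- The Hadamard gate followed by the bit flip `X ^ b`. -/
noncomputable def hadamardGate (b : Fin 2) : Matrix (Fin 2) (Fin 2) ℂ :=
  Matrix.of fun q s => ((√2 : ℝ) : ℂ)⁻¹ * signChar s (q + b)

theorem inv_sqrt_two_mul_self : ((√2 : ℝ) : ℂ)⁻¹ * ((√2 : ℝ) : ℂ)⁻¹ = 1 / 2 := by
  rw [← mul_inv, ← Complex.ofReal_mul, Real.mul_self_sqrt (by norm_num)]
  simp

theorem hadamardGate_isLocalClifford (b : Fin 2) : IsLocalClifford (hadamardGate b) := by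
  obtain ⟨ε, hε, h⟩ : ∃ ε : ℂ, (ε = 1 ∨ ε = -1) ∧
      hadamardGate b = ((√2 : ℝ) : ℂ)⁻¹ • !![1, ε; 1, -ε] := by
    refine ⟨signChar 1 b, ?_, ?_⟩
    · exact mul_self_eq_one_iff.1 (signChar_mul_self 1 b)
    · ext q s
      fin_cases b <;> fin_cases q <;> fin_cases s <;> simp [hadamardGate, signChar]
  have hstar : (hadamardGate b)ᴴ = ((√2 : ℝ) : ℂ)⁻¹ • !![1, 1; ε, -ε] := by
    rw [h]
    rcases hε with rfl | rfl <;> ext a c <;> fin_cases a <;> fin_cases c <;>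
      simp [Matrix.conjTranspose_apply]
  have hεε : ε * ε = 1 := mul_self_eq_one_iff.2 hε
  have hphase : IsPhase ε ∧ IsPhase (-ε) := by
    rcases hε with rfl | rfl <;> simp [IsPhase]
  have hconj : ∀ A p B : Matrix (Fin 2) (Fin 2) ℂ,
      (((√2 : ℝ) : ℂ)⁻¹ • A) * p * (((√2 : ℝ) : ℂ)⁻¹ • B) = (1 / 2 : ℂ) • (A * p * B) := by
    intro A p B
    rw [Matrix.smul_mul, Matrix.smul_mul, Matrix.mul_smul, smul_smul, inv_sqrt_two_mul_self]
  refine isLocalClifford_of_conj_mem ?_ (fun p hp => ?_) fun p hp => ?_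
  · rw [Matrix.mem_unitaryGroup_iff, Matrix.star_eq_conjTranspose, hstar, h,
      ← Matrix.mul_one (((√2 : ℝ) : ℂ)⁻¹ • !![1, ε; 1, -ε]), hconj]
    ext a c
    fin_cases a <;> fin_cases c <;> simp [hεε] <;> norm_num
  · rw [hstar, h, hconj]
    rcases hp with rfl | rfl | rfl | rfl
    · refine ⟨1, 1, Or.inl rfl, Or.inl rfl, ?_⟩
      ext a c
      fin_cases a <;> fin_cases c <;> simp [hεε] <;> norm_num
    · refine ⟨ε, pauliZ, hphase.1, by simp [IsPauli], ?_⟩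
      ext a c
      rcases hε with rfl | rfl <;> fin_cases a <;> fin_cases c <;>
        simp [pauliX, pauliZ] <;> norm_num
    · refine ⟨-ε, pauliY, hphase.2, by simp [IsPauli], ?_⟩
      ext a c
      rcases hε with rfl | rfl <;> fin_cases a <;> fin_cases c <;>
        simp [pauliY] <;> ring
    · refine ⟨1, pauliX, Or.inl rfl, by simp [IsPauli], ?_⟩
      ext a c
      fin_cases a <;> fin_cases c <;> simp [pauliX, pauliZ, hεε] <;> norm_num
  · rw [hstar, h, hconj]
    rcases hp with rfl | rfl | rfl | rfl
    · refine ⟨1, 1, Or.inl rfl, Or.inl rfl, ?_⟩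
      ext a c
      rcases hε with rfl | rfl <;> fin_cases a <;> fin_cases c <;> simp <;> norm_num
    · refine ⟨1, pauliZ, Or.inl rfl, by simp [IsPauli], ?_⟩
      ext a c
      rcases hε with rfl | rfl <;> fin_cases a <;> fin_cases c <;>
        simp [pauliX, pauliZ] <;> norm_num
    · refine ⟨-ε, pauliY, hphase.2, by simp [IsPauli], ?_⟩
      ext a c
      rcases hε with rfl | rfl <;> fin_cases a <;> fin_cases c <;>
        simp [pauliY] <;> ring
    · refine ⟨ε, pauliX, hphase.1, by simp [IsPauli], ?_⟩
      ext a c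
      rcases hε with rfl | rfl <;> fin_cases a <;> fin_cases c <;>
        simp [pauliX, pauliZ] <;> norm_num

/-- Character orthogonality: the gate turns the sign produced by CZ gates into an affine constraint
on the label. -/
theorem sum_hadamardGate_mul_signChar (b q a : Fin 2) :
    ∑ s, hadamardGate b q s * signChar s a =
      if q = b + a then ((√2 : ℝ) : ℂ)⁻¹ * 2 else 0 := by
  fin_cases b <;> fin_cases q <;> fin_cases a <;>
    simp [hadamardGate, signChar, Fin.sum_univ_two, mul_two] <;> ring

/-! ### Graph states with local Clifford gates -/

theorem signChar_sum {N : ℕ} (a : Fin 2) (K : Finset (Fin N)) (f : Fin N → Fin 2) :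
    signChar a (∑ k ∈ K, f k) = ∏ k ∈ K, signChar a (f k) := by
  induction K using Finset.cons_induction with
  | empty => simp
  | cons k K hk ih => rw [Finset.sum_cons, Finset.prod_cons, signChar_add_right, ih]

/-- Every stabilizer state is a graph state with Clifford gates, where the qubits with a gate that
is not diagonal are pairwise not adjacent. -/
theorem IsStabilizerState.exists_graphState {N : ℕ} {Ψ : Config N → ℂ}
    (hΨ : IsStabilizerState Ψ) :
    ∃ (F : Finset (Fin N)) (G : SimpleGraph (Fin N)) (u : Fin N → Matrix (Fin 2) (Fin 2) ℂ)
      (κ : ℂ), κ ≠ 0 ∧ (∀ j, IsLocalClifford (u j)) ∧ (∀ j ∈ F, (u j).IsDiag) ∧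
      (∀ s t, G.Adj s t → s ∈ F ∨ t ∈ F) ∧ Ψ = κ • (tensorOp u *ᵥ graphState G) := by
  classical
  obtain ⟨F, X, q₀, τ, σ, κ, hκ, hq₀, hX, hτ, hσ, hΨq⟩ := hΨ.exists_normal_form
  -- Each edge gets one orientation: from larger to smaller inside `F`, and from `F` outwards.
  set r : Fin N → Fin N → Prop := fun s t =>
    (s ∈ F ∧ t ∈ F ∧ t < s ∧ σ s t = -1) ∨ (s ∈ F ∧ t ∉ F ∧ X s t = 1) with hr
  have hrF : ∀ s t, r s t → s ∈ F := by rintro s t (h | h) <;> exact h.1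
  have hrr : ∀ s t, r s t → ¬ r t s := by
    rintro s t (h | h) (h' | h')
    · exact lt_asymm h.2.2.1 h'.2.2.1
    · exact h'.2.1 h.1
    · exact h.2.1 h'.1
    · exact h.2.1 h'.1
  set u : Fin N → Matrix (Fin 2) (Fin 2) ℂ := fun j =>
    if j ∈ F then phaseGate (τ j) else hadamardGate (q₀ j) with hu
  set s2 : ℂ := ((√2 : ℝ) : ℂ)⁻¹ * 2 with hs2
  have hs2ne : s2 ≠ 0 := by simp [hs2]
  have huF : ∀ j ∈ F, (u j).IsDiag := by
    intro j hj
    simp only [hu, hj, if_true]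
    exact phaseGate_isDiag _
  -- Each Hadamard sum outside `F` leaves a factor `s2`, divided out here.
  refine ⟨F, SimpleGraph.fromRel r, u, κ * (∏ j ∈ Fᶜ, s2)⁻¹,
    mul_ne_zero hκ (inv_ne_zero (Finset.prod_ne_zero_iff.2 fun _ _ => hs2ne)), fun j => ?_, huF,
    ?_, ?_⟩
  · simp only [hu]
    split_ifs
    · exact phaseGate_isLocalClifford (hτ j)
    · exact hadamardGate_isLocalClifford _
  · rintro s t ⟨-, h | h⟩
    · exact Or.inl (hrF _ _ h)
    · exact Or.inr (hrF _ _ h)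
  have hgraph : ∀ p : Config N, graphState (SimpleGraph.fromRel r) p =
      (∏ s ∈ F, ∏ t ∈ F with t < s, if σ s t = -1 then signChar (p s) (p t) else 1) *
        ∏ t ∈ Fᶜ, ∏ s ∈ F, if X s t = 1 then signChar (p s) (p t) else 1 := by
    intro p
    rw [graphState_eq_prod_prod _ p (fun s t => if r s t then signChar (p s) (p t) else 1)
      (fun s => if_neg fun h => hrr s s h h)]
    · rw [Finset.prod_comm (s := Fᶜ), ← Finset.prod_mul_distrib]
      rw [← Finset.prod_subset (Finset.subset_univ F)]
      · refine Finset.prod_congr rfl fun s hs => ?_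
        rw [← Finset.prod_mul_prod_compl F, Finset.prod_filter]
        congr 1
        · refine Finset.prod_congr rfl fun t ht => ?_
          simp only [hr, hs, ht, true_and, not_true, false_and, and_false, or_false, ite_and]
        · refine Finset.prod_congr rfl fun t ht => ?_
          have ht : t ∉ F := Finset.mem_compl.1 ht
          simp only [hr, hs, ht, true_and, not_false_eq_true, false_and, false_or]
      · exact fun s _ hs => Finset.prod_eq_one fun t _ => if_neg fun h => hs (hrF _ _ h)
    · intro s t hst
      by_cases h : r s t
      · simp [h, hrr s t h, hst]
      · by_cases h' : r t s
        · simp [h, h', hst, signChar_comm (p t)]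
        · simp [h, h']
  have hmul : ∀ q, (tensorOp u *ᵥ graphState (SimpleGraph.fromRel r)) q =
      (∏ s ∈ F, ∏ t ∈ F with t < s, if σ s t = -1 then signChar (q s) (q t) else 1) *
        ((∏ j ∈ F, if q j = 1 then τ j else 1) *
          ∏ t ∈ Fᶜ, if q t = q₀ t + ∑ s ∈ F with q s = 1, X s t then s2 else 0) := by
    intro q
    -- Diagonal gates freeze the labels on `F` to those of `q`. As no edge lies outside `F`, the
    -- remaining sum factors over sites with weights `w`.
    set w : Fin N → Fin 2 → ℂ := fun j a => u j (q j) a *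
      if j ∈ F then 1 else ∏ s ∈ F, if X s j = 1 then signChar (q s) a else 1 with hw
    have hsum : ∀ p, (∏ j, u j (q j) (p j)) * graphState (SimpleGraph.fromRel r) p =
        (∏ s ∈ F, ∏ t ∈ F with t < s, if σ s t = -1 then signChar (q s) (q t) else 1) *
          ∏ j, w j (p j) := by
      intro p
      by_cases hp : ∀ j ∈ F, p j = q j
      · rw [hgraph]
        simp only [hw, Finset.prod_mul_distrib]
        have h1 : (∏ s ∈ F, ∏ t ∈ F with t < s,
            if σ s t = -1 then signChar (p s) (p t) else 1) =
            ∏ s ∈ F, ∏ t ∈ F with t < s, if σ s t = -1 then signChar (q s) (q t) else 1 := by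
          refine Finset.prod_congr rfl fun s hs => Finset.prod_congr rfl fun t ht => ?_
          rw [hp s hs, hp t (Finset.mem_filter.1 ht).1]
        have h2 : (∏ t ∈ Fᶜ, ∏ s ∈ F, if X s t = 1 then signChar (p s) (p t) else 1) =
            ∏ j, if j ∈ F then 1 else
              ∏ s ∈ F, if X s j = 1 then signChar (q s) (p j) else 1 := by
          rw [← Finset.prod_mul_prod_compl F,
            Finset.prod_eq_one (s := F) fun j hj => if_pos hj, one_mul]
          refine Finset.prod_congr rfl fun t ht => ?_
          rw [if_neg (Finset.mem_compl.1 ht)]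
          exact Finset.prod_congr rfl fun s hs => by rw [hp s hs]
        rw [h1, h2]
        ring
      · push Not at hp
        obtain ⟨j, hj, hne⟩ := hp
        have h0 : u j (q j) (p j) = 0 := huF j hj (Ne.symm hne)
        rw [Finset.prod_eq_zero (Finset.mem_univ j) h0,
          Finset.prod_eq_zero (f := fun j => w j (p j)) (Finset.mem_univ j)
            (by simp only [hw, h0, zero_mul]), zero_mul, mul_zero]
    simp only [Matrix.mulVec, dotProduct, tensorOp, Matrix.of_apply]
    rw [Finset.sum_congr rfl fun p _ => hsum p, ← Finset.mul_sum]
    congr 1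
    have := (Finset.prod_univ_sum (fun _ : Fin N => (Finset.univ : Finset (Fin 2))) w).symm
    simp only [Fintype.piFinset_univ] at this
    rw [this, ← Finset.prod_mul_prod_compl F]
    congr 1
    · refine Finset.prod_congr rfl fun j hj => ?_
      rw [Finset.sum_eq_single (q j) _ (by simp)]
      · simp only [hw, hu, hj, if_true, mul_one]
        generalize q j = a
        fin_cases a <;> simp [phaseGate]
      · intro a _ ha
        have h0 : u j (q j) a = 0 := huF j hj (Ne.symm ha)
        simp only [hw, h0, zero_mul]
    · refine Finset.prod_congr rfl fun t ht => ?_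
      have ht : t ∉ F := Finset.mem_compl.1 ht
      rw [← sum_hadamardGate_mul_signChar]
      refine Finset.sum_congr rfl fun a _ => ?_
      simp only [hw, hu, ht, if_false]
      rw [signChar_sum, Finset.prod_filter]
      congr 1
      refine Finset.prod_congr rfl fun s _ => ?_
      unfold signChar
      generalize q s = x
      generalize X s t = y
      fin_cases x <;> fin_cases y <;> simp
  funext q
  rw [Pi.smul_apply, smul_eq_mul, hmul, hΨq]
  have hcond : (q = q₀ + ∑ j ∈ F with q j = 1, X j) ↔
      ∀ t ∈ Fᶜ, q t = q₀ t + ∑ s ∈ F with q s = 1, X s t := by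
    constructor
    · intro h t _
      have := congrFun h t
      rwa [Pi.add_apply, Finset.sum_apply] at this
    · intro h
      funext t
      by_cases ht : t ∈ F
      · rw [Pi.add_apply, sum_dual_apply hX q ht, hq₀ t ht, zero_add]
      · rw [Pi.add_apply, Finset.sum_apply]
        exact h t (Finset.mem_compl.2 ht)
  split_ifs with h
  · rw [Finset.prod_congr rfl fun t ht => if_pos (hcond.1 h t ht)]
    have hA : (∏ s ∈ F, ∏ t ∈ F with t < s, if σ s t = -1 then signChar (q s) (q t) else 1) =
        ∏ s ∈ F with q s = 1, ∏ t ∈ (F.filter fun k => q k = 1) with t < s, σ s t := by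
      rw [Finset.prod_filter]
      refine Finset.prod_congr rfl fun s _ => ?_
      by_cases hs : q s = 1
      · rw [if_pos hs, Finset.filter_comm, Finset.prod_filter (p := fun k => q k = 1)]
        refine Finset.prod_congr rfl fun t _ => ?_
        rcases hσ s t with h | h
        · have : (1 : ℂ) ≠ -1 := by norm_num
          simp [h, this]
        · simp [h, signChar, hs]
      · rw [if_neg hs]
        refine Finset.prod_eq_one fun t _ => ?_
        simp [signChar, hs]
    rw [hA, ← Finset.prod_filter, Finset.prod_mul_distrib]
    have hne : (∏ j ∈ Fᶜ, s2) ≠ 0 := Finset.prod_ne_zero_iff.2 fun _ _ => hs2ne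
    field_simp
  · rw [hcond] at h
    push Not at h
    obtain ⟨t, ht, hne⟩ := h
    have h0 : (∏ t ∈ Fᶜ, if q t = q₀ t + ∑ s ∈ F with q s = 1, X s t then s2 else 0) = 0 :=
      Finset.prod_eq_zero ht (if_neg hne)
    rw [h0, mul_zero, mul_zero, mul_zero]

/-! ### The vertex cover and the network -/

/-- If all edges meet `F`, there is an ordered vertex cover that omits one vertex and for which
all vertices outside `F` have valency at most one. -/
theorem exists_orderedVertexCover {N : ℕ} {G : SimpleGraph (Fin N)} {F : Finset (Fin N)}
    (hF : ∀ s t, G.Adj s t → s ∈ F ∨ t ∈ F) :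
    ∃ c : List (Fin N), IsOrderedVertexCover G c ∧ c.length = N - 1 ∧
      ∀ j ∉ F, valency G c j ≤ 1 := by
  classical
  -- Omitting one vertex keeps a cover, since an edge has two distinct endpoints.
  set l := Fᶜ.toList ++ F.toList with hl
  have hnodup : l.Nodup := by
    rw [hl, List.nodup_append]
    refine ⟨Finset.nodup_toList _, Finset.nodup_toList _, fun a ha b hb hab => ?_⟩
    rw [Finset.mem_toList] at ha hb
    exact Finset.mem_compl.1 ha (hab ▸ hb)
  have hmem : ∀ a, a ∈ l := by
    intro a
    simp only [hl, List.mem_append, Finset.mem_toList, Finset.mem_compl]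
    exact (em (a ∈ F)).symm
  have hlen : l.length = N := by
    rw [hl, List.length_append, Finset.length_toList, Finset.length_toList,
      Finset.card_compl_add_card, Fintype.card_fin]
  have hcnodup : l.dropLast.Nodup := hnodup.sublist (List.dropLast_sublist l)
  refine ⟨l.dropLast, ⟨hcnodup, ?_⟩, by rw [List.length_dropLast, hlen], fun j hj => ?_⟩
  · intro s t hst
    by_contra! h
    have hne : l ≠ [] := List.ne_nil_of_mem (hmem s)
    have hlast : ∀ a, a ∉ l.dropLast → a = l.getLast hne := by
      intro a ha
      have := hmem a
      rw [← List.dropLast_append_getLast hne, List.mem_append] at this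
      simpa using this.resolve_left ha
    exact hst.ne ((hlast s h.1).trans (hlast t h.2).symm)
  · have hown : ∀ i, Linked G l.dropLast i j → j = l.dropLast.get i := by
      rintro i (h | ⟨hadj, hj'⟩)
      · exact h
      · exfalso
        have hi : (i : ℕ) < l.length - 1 := i.2.trans_eq List.length_dropLast
        have hget : l.dropLast.get i = l[(i : ℕ)] := by simp
        have hiF : l[(i : ℕ)] ∈ F := hget ▸ (hF _ _ hadj).resolve_right hj
        have hle : Fᶜ.toList.length ≤ i := by
          by_contra! hlt
          have h1 : l[(i : ℕ)] = Fᶜ.toList[(i : ℕ)] := List.getElem_append_left hlt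
          have h2 : l[(i : ℕ)] ∈ Fᶜ := by
            rw [← Finset.mem_toList, h1]
            exact List.getElem_mem hlt
          exact Finset.mem_compl.1 h2 hiF
        have htake : ∀ n, n ≤ l.length - 1 → Fᶜ.toList.length ≤ n → j ∈ l.dropLast.take n := by
          intro n hn hle
          rw [List.dropLast_eq_take, List.take_take, min_eq_left hn, hl, List.take_append,
            List.take_of_length_le hle]
          exact List.mem_append_left _ (Finset.mem_toList.2 (Finset.mem_compl.2 hj))
        exact hj' (htake i hi.le hle)
    rw [valency, Finset.card_le_one]
    intro i hi i' hi'
    have h1 := hown i (Finset.mem_filter.1 hi).2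
    have h2 := hown i' (Finset.mem_filter.1 hi').2
    exact List.nodup_iff_injective_get.1 hcnodup (h1.symm.trans h2)

theorem valency_pos_iff {N : ℕ} {G : SimpleGraph (Fin N)} {c : List (Fin N)} {j : Fin N} :
    0 < valency G c j ↔ ∃ i, Linked G c i j := by
  simp [valency, Finset.card_pos, Finset.filter_nonempty_iff]

theorem eq_of_linked_of_valency_le_one {N : ℕ} {G : SimpleGraph (Fin N)} {c : List (Fin N)}
    {j : Fin N} (h : valency G c j ≤ 1) {i i' : Fin c.length} (hi : Linked G c i j)
    (hi' : Linked G c i' j) : i = i' :=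
  Finset.card_le_one.1 h i (by simpa using hi) i' (by simpa using hi')

theorem exists_nqsState_absorb_eq {N : ℕ} {G : SimpleGraph (Fin N)} {c : List (Fin N)}
    (hc : IsOrderedVertexCover G c) (hpos : 0 < c.length)
    {u : Fin N → Matrix (Fin 2) (Fin 2) ℂ} (hd : ∀ j, (u j).IsDiag ∨ valency G c j ≤ 1) :
    ∃ σ : Fin N → Fin c.length, (∀ j, 0 < valency G c j → Linked G c (σ j) j) ∧
      nqsState (absorb u σ (graph2nqs G c)) = tensorOp u *ᵥ graphState G := by
  have hσ : ∀ j, ∃ i : Fin c.length, 0 < valency G c j → Linked G c i j := by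
    intro j
    by_cases h : 0 < valency G c j
    · exact (valency_pos_iff.1 h).imp fun i hi _ => hi
    · exact ⟨⟨0, hpos⟩, fun h' => absurd h' h⟩
  choose σ hσ using hσ
  refine ⟨σ, hσ, ?_⟩
  rw [nqsState_absorb, nqsState_graph2nqs hc]
  intro j
  refine (hd j).imp_right fun hv i hi k a b => ?_
  have hnl : ¬ Linked G c i j := fun hl =>
    hi (eq_of_linked_of_valency_le_one hv hl (hσ j (valency_pos_iff.2 ⟨i, hl⟩)))
  rw [graph2nqs_apply_of_not_linked hnl, graph2nqs_apply_of_not_linked hnl]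

/-- A gate acts on the column index, so equal rows stay equal even if `σ j` is not linked to `j`. -/
theorem absorb_graph2nqs_row_eq {N : ℕ} {G : SimpleGraph (Fin N)} {c : List (Fin N)}
    (u : Fin N → Matrix (Fin 2) (Fin 2) ℂ) (σ : Fin N → Fin c.length) {i : Fin c.length}
    {j : Fin N} (h : ¬ Linked G c i j) :
    absorb u σ (graph2nqs G c) i j 0 = absorb u σ (graph2nqs G c) i j 1 := by
  funext k
  unfold absorb
  split_ifs <;> simp [Matrix.mul_apply, graph2nqs_apply_of_not_linked h]

end StabNQS

theorem theorem1 (N : ℕ) (hN : 1 ≤ N) (Ψ : StabNQS.Config N → ℂ)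
    (hΨ : StabNQS.IsStabilizerState Ψ) :
    ∃ (G : SimpleGraph (Fin N)) (c : List (Fin N)) (u : Fin N → Matrix (Fin 2) (Fin 2) ℂ),
      StabNQS.IsOrderedVertexCover G c ∧ c.length ≤ N - 1 ∧
      (∀ j, StabNQS.IsLocalClifford (u j)) ∧
      (∀ j, (u j).IsDiag ∨ StabNQS.valency G c j ≤ 1) ∧
      (∃ κ : ℂ, κ ≠ 0 ∧ Ψ = κ • (StabNQS.tensorOp u).mulVec (StabNQS.graphState G)) ∧
      StabNQS.IsVMJState G c Ψ ∧
      (2 ≤ N → ∃ (σ : Fin N → Fin c.length) (κ : ℂ), κ ≠ 0 ∧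
        (∀ j, 0 < StabNQS.valency G c j → StabNQS.Linked G c (σ j) j) ∧
        Ψ = κ • StabNQS.nqsState (StabNQS.absorb u σ (StabNQS.graph2nqs G c))) ∧
      StabNQS.IsRBMLimit G c Ψ := by

  obtain ⟨F, G, u, κ, hκ, hu, hdiag, hF, hΨu⟩ := hΨ.exists_graphState
  obtain ⟨c, hc, hlen, hval⟩ := StabNQS.exists_orderedVertexCover hF
  have hd : ∀ j, (u j).IsDiag ∨ StabNQS.valency G c j ≤ 1 := fun j =>
    (em (j ∈ F)).imp (hdiag j) (hval j)
  have hunit : ∀ j, IsUnit (u j) := fun j =>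
    ⟨⟨u j, star (u j), Matrix.mem_unitaryGroup_iff.1 (hu j).1,
      Matrix.mem_unitaryGroup_iff'.1 (hu j).1⟩, rfl⟩
  refine ⟨G, c, u, hc, hlen.le, hu, hd, ⟨κ, hκ, hΨu⟩,
    StabNQS.isVMJState_of_eq_tensorOp hunit hd hκ hΨu, fun h2 => ?_, ?_⟩
  · obtain ⟨σ, hσ, hnqs⟩ := StabNQS.exists_nqsState_absorb_eq hc (by omega) hd
    exact ⟨σ, κ, hκ, hσ, hnqs ▸ hΨu⟩
  · rcases hN.eq_or_lt with rfl | h2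
    -- For a single qubit there is no hidden unit; `Ψ` itself serves as the one-site factor.
    · have h0 : c = [] := List.eq_nil_of_length_eq_zero hlen
      subst h0
      refine StabNQS.isRBMLimit_of_eq 1 (fun _ k => Ψ fun _ => k) (StabNQS.graph2nqs G [])
        (fun i => i.elim0) fun q => ?_
      have hq : q = fun _ => q 0 := funext fun j => by rw [Subsingleton.elim j 0]
      simp [StabNQS.nqsState, ← hq]
    · obtain ⟨σ, hσ, hnqs⟩ := StabNQS.exists_nqsState_absorb_eq hc (by omega) hd
      refine StabNQS.isRBMLimit_of_eq κ (fun _ _ => 1)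
        (StabNQS.absorb u σ (StabNQS.graph2nqs G c))
        (fun i j h => StabNQS.absorb_graph2nqs_row_eq u σ h) fun q => ?_
      rw [hnqs, hΨu]
      simp
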